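/- Let $n\ge 0$, let $\mathcal L$ be the space of linear operators on $(\mathbb C^2)^{\otimes n}$, and let $\sigma_1,\dots,\sigma_{4^n}$ be the normalized Pauli operators, i.e. the operators $2^{-n/2}P_1\otimes\cdots\otimes P_n$ with $P_j\in\{\mathbb I,X,Y,Z\}$. The Pauli-Liouville representation of a linear map $\Lambda:\mathcal L\to\mathcal L$ is the $4^n\times 4^n$ matrix with entries $\Lambda_{ij}=\operatorname{tr}(\sigma_i\Lambda(\sigma_j))$. For a unitary $G$ on $(\mathbb C^2)^{\otimes n}$, let $\mathcal G$ be the Pauli-Liouville matrix of $O\mapsto GOG^\dagger$; the map $G\mapsto\mathcal G$ is the Pauli-Liouville representation of any group of $n$-qubit unitaries. A quantum channel is a completely positive, trace-preserving linear map $\mathcal L\to\mathcal L$. Let $\mathsf G$ be a finite subgroup of the unitary group of $(\mathbb C^2)^{\otimes n}$. Suppose that there is an invertible complex $4^n\times 4^n$ matrix $\mathcal V$ such that, for every quantum channel $\Lambda$, the matrix $\mathcal V\Lambda_G\mathcal V^{-1}$ is diagonal, where $$\Lambda_G=\frac1{|\mathsf G|}\sum_{G\in\mathsf G}\mathcal G\Lambda\mathcal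 G^\dagger$$ is the $\mathsf G$-twirl of $\Lambda$ in the Pauli-Liouville representation. Then the Pauli-Liouville representation of $\mathsf G$ is multiplicity-free: it is a direct sum of pairwise inequivalent irreducible complex representations. Consequently $|\mathsf G|\ge 4^n$; this bound holds also when elements of $\mathsf G$ that differ by a global phase are identified. -/

import Mathlib

namespace PauliTwirl

/-- Labels of the computational basis of `n` qubits (bit strings). -/
abbrev Bits (n : ℕ) : Type := Fin n → Fin 2

/-- Labels of the `4 ^ n` Pauli strings on `n` qubits. -/
abbrev PauliIdx (n : ℕ) : Type := Fin n → Fin 4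

/-- Linear operators on the `2 ^ n`-dimensional Hilbert space of `n` qubits. -/
abbrev Op (n : ℕ) : Type := Matrix (Bits n) (Bits n) ℂ

/-- The group of unitary operators on `n` qubits. -/
abbrev QubitUnitary (n : ℕ) : Type := Matrix.unitaryGroup (Bits n) ℂ

/-- The single-qubit Pauli matrices `I, X, Y, Z`. -/
def pauliMatrix : Fin 4 → Matrix (Fin 2) (Fin 2) ℂ
  | 0 => !![1, 0; 0, 1]
  | 1 => !![0, 1; 1, 0]
  | 2 => !![0, -Complex.I; Complex.I, 0]
  | 3 => !![1, 0; 0, -1]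

/-- The Pauli string `P_{s 0} ⊗ ⋯ ⊗ P_{s (n-1)}`. -/
def pauliString {n : ℕ} (s : PauliIdx n) : Op n :=
  Matrix.of fun x y => ∏ i, pauliMatrix (s i) (x i) (y i)

/-- The normalized Pauli operators `σ_s = P_s / √(2 ^ n)`. -/
noncomputable def normPauli {n : ℕ} (s : PauliIdx n) : Op n :=
  ((Real.sqrt (2 ^ n) : ℂ))⁻¹ • pauliString s

/-- The Pauli-Liouville matrix of a linear map on operators: `Λ_{st} = tr (σ_s Λ(σ_t))`. -/
noncomputable def liouville {n : ℕ} (Λ : Op n →ₗ[ℂ] Op n) :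
    Matrix (PauliIdx n) (PauliIdx n) ℂ :=
  Matrix.of fun s t => Matrix.trace (normPauli s * Λ (normPauli t))

/-- The unitary channel `O ↦ U O U†`. -/
noncomputable def unitaryChannel {n : ℕ} (U : QubitUnitary n) : Op n →ₗ[ℂ] Op n :=
  LinearMap.mulLeft ℂ (U : Op n) ∘ₗ LinearMap.mulRight ℂ (star (U : Op n))

open scoped Matrix.Norms.L2Operator MatrixOrder CStarAlgebra in
/-- Quantum channels: completely positive, trace-preserving linear maps. The order on matrices is
the Loewner order. -/
def IsQuantumChannel {n : ℕ} (Λ : Op n →ₗ[ℂ] Op n) : Prop :=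
  (∃ Φ : Op n →CP Op n, ∀ X, Φ X = Λ X) ∧ ∀ X, Matrix.trace (Λ X) = Matrix.trace X

/-- The twirl `Λ_G = E_{g ∈ G} 𝒢 Λ 𝒢†` in the Pauli-Liouville representation. -/
noncomputable def twirl {n : ℕ} (G : Subgroup (QubitUnitary n)) [Fintype G]
    (Λ : Op n →ₗ[ℂ] Op n) : Matrix (PauliIdx n) (PauliIdx n) ℂ :=
  (Fintype.card G : ℂ)⁻¹ •
    ∑ g : G, liouville (unitaryChannel (g : QubitUnitary n)) * liouville Λ *
      (liouville (unitaryChannel (g : QubitUnitary n))).conjTranspose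

theorem pauliMatrix_complete (a b c d : Fin 2) :
    ∑ p, pauliMatrix p a b * pauliMatrix p c d = if a = d ∧ b = c then 2 else 0 := by
  fin_cases a <;> fin_cases b <;> fin_cases c <;> fin_cases d <;>
    norm_num [Fin.sum_univ_four, pauliMatrix]

theorem pauliMatrix_orthogonal (p q : Fin 4) :
    ∑ a, ∑ b, pauliMatrix p a b * pauliMatrix q b a = if p = q then 2 else 0 := by
  fin_cases p <;> fin_cases q <;> norm_num [Fin.sum_univ_two, pauliMatrix]

theorem sqrt_inv_mul_self (n : ℕ) :
    ((Real.sqrt (2 ^ n) : ℂ))⁻¹ * ((Real.sqrt (2 ^ n) : ℂ))⁻¹ = ((2 : ℂ) ^ n)⁻¹ := by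
  rw [← mul_inv, ← Complex.ofReal_mul, Real.mul_self_sqrt (by positivity)]
  norm_num

theorem normPauli_complete {n : ℕ} (a b c d : Bits n) :
    ∑ s, normPauli s a b * normPauli s c d = if a = d ∧ b = c then 1 else 0 := by
  have h : ∑ s : PauliIdx n, pauliString s a b * pauliString s c d =
      if a = d ∧ b = c then 2 ^ n else 0 := by
    simp only [pauliString, Matrix.of_apply, ← Finset.prod_mul_distrib]
    rw [← Fintype.prod_sum fun (i : Fin n) (p : Fin 4) =>
      pauliMatrix p (a i) (b i) * pauliMatrix p (c i) (d i)]
    simp only [pauliMatrix_complete]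
    split_ifs with hx
    · obtain ⟨rfl, rfl⟩ := hx
      simp
    · rw [not_and_or, funext_iff, funext_iff, not_forall, not_forall] at hx
      obtain ⟨i, hi⟩ | ⟨i, hi⟩ := hx <;>
        exact Finset.prod_eq_zero (Finset.mem_univ i) (by simp [hi])
  have hs : ∀ s : PauliIdx n, normPauli s a b * normPauli s c d =
      ((2 : ℂ) ^ n)⁻¹ * (pauliString s a b * pauliString s c d) := fun s => by
    rw [← sqrt_inv_mul_self]
    simp only [normPauli, Matrix.smul_apply, smul_eq_mul]
    ring
  simp only [hs, ← Finset.mul_sum, h]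
  split_ifs <;> simp

/-- The normalized Pauli operators are orthonormal. -/
theorem trace_normPauli_mul {n : ℕ} (s t : PauliIdx n) :
    Matrix.trace (normPauli s * normPauli t) = if s = t then 1 else 0 := by
  have h : Matrix.trace (pauliString s * pauliString t) = if s = t then (2 : ℂ) ^ n else 0 := by
    simp only [pauliString, Matrix.trace, Matrix.diag, Matrix.mul_apply, Matrix.of_apply,
      ← Finset.prod_mul_distrib]
    have hy : ∀ x : Bits n, ∑ y : Bits n, ∏ i, pauliMatrix (s i) (x i) (y i) *
        pauliMatrix (t i) (y i) (x i) =
        ∏ i, ∑ b, pauliMatrix (s i) (x i) b * pauliMatrix (t i) b (x i) := fun x =>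
      (Fintype.prod_sum fun (i : Fin n) (b : Fin 2) =>
        pauliMatrix (s i) (x i) b * pauliMatrix (t i) b (x i)).symm
    simp only [hy]
    rw [← Fintype.prod_sum fun (i : Fin n) (a : Fin 2) =>
      ∑ b, pauliMatrix (s i) a b * pauliMatrix (t i) b a]
    simp only [pauliMatrix_orthogonal]
    split_ifs with hx
    · subst hx
      simp
    · rw [funext_iff, not_forall] at hx
      obtain ⟨i, hi⟩ := hx
      exact Finset.prod_eq_zero (Finset.mem_univ i) (by simp [hi])
  simp only [normPauli, Matrix.smul_mul, Matrix.mul_smul, Matrix.trace_smul, smul_smul,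
    sqrt_inv_mul_self, h, smul_eq_mul]
  split_ifs <;> simp

/-- Every operator is `O = ∑ tr (σ_s O) σ_s`. -/
theorem sum_trace_smul_normPauli {n : ℕ} (O : Op n) :
    ∑ s, Matrix.trace (normPauli s * O) • normPauli s = O := by
  ext c d
  simp only [Matrix.sum_apply, Matrix.smul_apply, smul_eq_mul, Matrix.trace, Matrix.diag,
    Matrix.mul_apply, Finset.sum_mul]
  rw [Finset.sum_comm]
  have hx : ∀ x : Bits n, ∑ s : PauliIdx n, ∑ y, normPauli s x y * O y x * normPauli s c d =
      ∑ y, (if x = d ∧ y = c then 1 else 0) * O y x := by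
    intro x
    rw [Finset.sum_comm]
    refine Finset.sum_congr rfl fun y _ => ?_
    rw [← normPauli_complete, Finset.sum_mul]
    exact Finset.sum_congr rfl fun s _ => by ring
  simp only [hx]
  simp [ite_and]

theorem liouville_id (n : ℕ) : liouville (LinearMap.id : Op n →ₗ[ℂ] Op n) = 1 := by
  ext s t
  simp [liouville, trace_normPauli_mul, Matrix.one_apply]

theorem liouville_comp {n : ℕ} (Λ Γ : Op n →ₗ[ℂ] Op n) :
    liouville (Λ ∘ₗ Γ) = liouville Λ * liouville Γ := by
  ext s t
  simp only [liouville, Matrix.mul_apply, Matrix.of_apply, LinearMap.comp_apply]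
  conv_lhs => rw [← sum_trace_smul_normPauli (Γ (normPauli t))]
  simp only [map_sum, map_smul, Matrix.mul_sum, Matrix.mul_smul, Matrix.trace_sum,
    Matrix.trace_smul, smul_eq_mul]
  exact Finset.sum_congr rfl fun u _ => mul_comm _ _

/-- The Pauli-Liouville representation of the unitary group, on `ℂ ^ (4 ^ n)`: the unitary `U` acts
through the Pauli-Liouville matrix of `O ↦ U O U†`. -/
noncomputable def liouvilleRep (n : ℕ) : Representation ℂ (QubitUnitary n) (PauliIdx n → ℂ) where
  toFun U := Matrix.toLin' (liouville (unitaryChannel U))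
  map_one' := by
    have h : unitaryChannel (1 : QubitUnitary n) = LinearMap.id := by
      ext1 X
      simp [unitaryChannel]
    rw [h, liouville_id, Matrix.toLin'_one]
    rfl
  map_mul' U V := by
    have h : unitaryChannel (U * V) = unitaryChannel U ∘ₗ unitaryChannel V := by
      ext1 X
      simp [unitaryChannel, mul_assoc]
    rw [h, liouville_comp, Matrix.toLin'_mul]
    rfl

/-- The Pauli-Liouville representation of a group `G` of `n`-qubit unitaries. -/
noncomputable def groupLiouvilleRep {n : ℕ} (G : Subgroup (QubitUnitary n)) :
    Representation ℂ G (PauliIdx n → ℂ) :=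
  (liouvilleRep n).comp G.subtype

/-- A representation is multiplicity-free if it is an internal direct sum of irreducible
subrepresentations in which every irreducible representation appears at most once, up to
equivalence. -/
def IsMultiplicityFree {Γ V : Type} [Group Γ] [AddCommGroup V] [Module ℂ V]
    (ρ : Representation ℂ Γ V) : Prop :=
  ∃ (k : ℕ) (W : Fin k → Subrepresentation ρ),
    DirectSum.IsInternal (fun i => (W i).toSubmodule) ∧
    (∀ i, (W i).toRepresentation.IsIrreducible) ∧
    ∀ i j, Nonempty ((W i).toRepresentation.Equiv (W j).toRepresentation) → i = j

/-- The image of `G` in the projective unitary group, that is, the group `G` with elements that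
differ by a global phase identified. -/
def projectiveImage {n : ℕ} (G : Subgroup (QubitUnitary n)) :
    Subgroup (QubitUnitary n ⧸ Subgroup.center (QubitUnitary n)) :=
  G.map (QuotientGroup.mk' (Subgroup.center (QubitUnitary n)))

end PauliTwirl

/-! The heart is that the commutant of the Pauli-Liouville representation is commutative. A matrix
in the commutant equals its own twirl, so it is enough that `V` diagonalizes the twirls of enough
matrices. Channels span exactly the matrices whose row 0 is `(c, 0, …, 0)`, the form forced by trace
preservation (`DiagonalizesTwirls.isDiag_of_row`). Row 0 of a commutant element is the conjugate of
a fixed vector, and all fixed vectors are multiples of the identity's coordinate vector: any other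
would yield a nonzero nilpotent matrix that `V` diagonalizes
(`DiagonalizesTwirls.apply_eq_zero_of_fixed`). So `V` diagonalizes the whole commutant.

For a finite group, a commutative commutant excludes two equivalent independent subrepresentations,
hence multiplicities, and it also provides a cyclic vector. The orbit of that vector spans a space
of dimension `4 ^ n`. Global phases act trivially, so the orbit is indexed by the projective image,
and both cardinality bounds follow. -/

namespace PauliTwirl

/-! ### Finite group representations with commutative commutant -/

section RepresentationTheory

open scoped MonoidAlgebra

variable {Γ V : Type} [Group Γ] [AddCommGroup V] [Module ℂ V] {ρ : Representation ℂ Γ V}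

/-- Maschke's theorem: every subrepresentation of a finite group is the range of an equivariant
projection. -/
theorem exists_equivariant_projection [Finite Γ] (N : Subrepresentation ρ) :
    ∃ P : V →ₗ[ℂ] V, (∀ g, P ∘ₗ ρ g = ρ g ∘ₗ P) ∧ (∀ v, P v ∈ N) ∧ ∀ v ∈ N, P v = v := by
  have := Fintype.ofFinite Γ
  obtain ⟨p, hp⟩ := N.toSubmodule.exists_isCompl
  let q : V →ₗ[ℂ] V := Submodule.projection _ _ hp
  have hq : ∀ v, q v ∈ N.toSubmodule := fun v => by simp [q]
  have hq' : ∀ v ∈ N.toSubmodule, q v = v := fun v hv => by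
    exact Submodule.projection_apply_left hp ⟨v, hv⟩
  -- Average an arbitrary linear projection onto `N` over the group.
  refine ⟨(Fintype.card Γ : ℂ)⁻¹ • ∑ g, ρ g⁻¹ ∘ₗ q ∘ₗ ρ g, fun h => ?_, fun v => ?_, fun v hv => ?_⟩
  · ext v
    simp only [LinearMap.comp_apply, LinearMap.smul_apply, LinearMap.sum_apply, map_smul, map_sum]
    congr 1
    refine Fintype.sum_bijective (· * h) (Group.mulRight_bijective h) _ _ fun g => ?_
    rw [mul_inv_rev, map_mul, map_mul, Module.End.mul_apply, Module.End.mul_apply,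
      Representation.self_inv_apply]
  · rw [LinearMap.smul_apply, LinearMap.sum_apply]
    exact N.toSubmodule.smul_mem _ (N.toSubmodule.sum_mem fun g _ =>
      N.apply_mem_toSubmodule _ (hq _))
  · have h : ∀ g, ρ g⁻¹ (q (ρ g v)) = v := fun g => by
      rw [hq' _ (N.apply_mem_toSubmodule g hv), Representation.inv_self_apply]
    rw [LinearMap.smul_apply, LinearMap.sum_apply]
    simp only [LinearMap.comp_apply, h, Finset.sum_const, Finset.card_univ]
    rw [← Nat.cast_smul_eq_nsmul ℂ, smul_smul, inv_mul_cancel₀ (by simp), one_smul]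

/-- The commutant of `ρ` is commutative. -/
def HasCommutativeCommutant (ρ : Representation ℂ Γ V) : Prop :=
  ∀ A B : V →ₗ[ℂ] V, (∀ g, A ∘ₗ ρ g = ρ g ∘ₗ A) → (∀ g, B ∘ₗ ρ g = ρ g ∘ₗ B) →
    A ∘ₗ B = B ∘ₗ A

/-- The subrepresentation generated by a vector. -/
def cyclicSubrepresentation (ρ : Representation ℂ Γ V) (v : V) : Subrepresentation ρ where
  toSubmodule := Submodule.span ℂ (Set.range fun g => ρ g v)
  apply_mem_toSubmodule g w hw := by
    have h : Submodule.span ℂ (Set.range fun g => ρ g v) ≤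
        (Submodule.span ℂ (Set.range fun g => ρ g v)).comap (ρ g) := by
      rw [Submodule.span_le]
      rintro _ ⟨h, rfl⟩
      exact Submodule.subset_span ⟨g * h, by simp⟩
    exact h hw

theorem mem_cyclicSubrepresentation (v : V) :
    v ∈ (cyclicSubrepresentation ρ v).toSubmodule :=
  Submodule.subset_span ⟨1, by simp⟩

theorem cyclicSubrepresentation_le {v : V} {N : Subrepresentation ρ} (hv : v ∈ N.toSubmodule) :
    (cyclicSubrepresentation ρ v).toSubmodule ≤ N.toSubmodule := by
  refine Submodule.span_le.2 ?_
  rintro _ ⟨g, rfl⟩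
  exact N.apply_mem_toSubmodule g hv

/-- A representation with commutative commutant is cyclic. -/
theorem HasCommutativeCommutant.exists_cyclic [Finite Γ] [FiniteDimensional ℂ V]
    (hρ : HasCommutativeCommutant ρ) :
    ∃ v, Submodule.span ℂ (Set.range fun g => ρ g v) = ⊤ := by
  -- Take a cyclic subrepresentation that is maximal among the cyclic ones. If its complement `ker
  -- P` contained some `w ≠ 0`, then `v + w` would generate a larger one.
  obtain ⟨_, ⟨v, rfl⟩, hmax⟩ := WellFounded.has_min
    (wellFounded_gt (α := Submodule ℂ V))
    (Set.range fun v => (cyclicSubrepresentation ρ v).toSubmodule) ⟨_, 0, rfl⟩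
  refine ⟨v, ?_⟩
  obtain ⟨P, hP, hPmem, hPid⟩ := exists_equivariant_projection (cyclicSubrepresentation ρ v)
  suffices h : ∀ w, P w = 0 → w = 0 by
    refine eq_top_iff.2 fun x _ => ?_
    have hx := h (x - P x) (by rw [map_sub, hPid _ (hPmem x), sub_self])
    rw [sub_eq_zero.1 hx]
    exact hPmem x
  intro w hw
  obtain ⟨Q, hQ, hQmem, hQid⟩ := exists_equivariant_projection (cyclicSubrepresentation ρ (v + w))
  have hPu : P (v + w) = v := by
    rw [map_add, hw, add_zero, hPid _ (mem_cyclicSubrepresentation v)]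
  have hv : v ∈ (cyclicSubrepresentation ρ (v + w)).toSubmodule := by
    -- Commutativity gives `v = P (v + w) = P (Q (v + w)) = Q (P (v + w)) = Q v`.
    have h1 : Q v = v := by
      have h2 := LinearMap.congr_fun (hρ P Q hP hQ) (v + w)
      simp only [LinearMap.comp_apply] at h2
      rw [hQid _ (mem_cyclicSubrepresentation _), hPu] at h2
      exact h2.symm
    have h3 := hQmem v
    rwa [h1] at h3
  have hle := cyclicSubrepresentation_le hv
  have heq := eq_of_le_of_not_lt hle (hmax _ ⟨v + w, rfl⟩)
  have hu : w ∈ (cyclicSubrepresentation ρ v).toSubmodule := by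
    have h := Submodule.sub_mem _ (mem_cyclicSubrepresentation (ρ := ρ) (v + w)) hv
    rwa [← heq, add_sub_cancel_left] at h
  rw [← hPid w hu, hw]

/-- A representation with commutative commutant has no two equivalent independent
subrepresentations. -/
theorem HasCommutativeCommutant.eq_bot_of_equiv [Finite Γ] (hρ : HasCommutativeCommutant ρ)
    {W₁ W₂ : Subrepresentation ρ} (hd : Disjoint W₁.toSubmodule W₂.toSubmodule)
    (e : W₁.toRepresentation.Equiv W₂.toRepresentation) : W₁.toSubmodule = ⊥ := by
  obtain ⟨P, hP, hPmem, hPid⟩ := exists_equivariant_projection W₁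
  obtain ⟨Q, hQ, hQmem, hQid⟩ := exists_equivariant_projection W₂
  -- Project to `W₁`, then carry over to `W₂` by `e`. Here `Q E = E`, while `E Q = 0` because `P Q =
  -- Q P` maps into `W₁ ∩ W₂ = 0`; so `E = 0`, although it restricts to `e` on `W₁`.
  let E : V →ₗ[ℂ] V := W₂.toSubmodule.subtype ∘ₗ e.toLinearEquiv.toLinearMap ∘ₗ
    LinearMap.codRestrict W₁.toSubmodule P hPmem
  have hE_apply : ∀ x, E x = (e.toLinearEquiv ⟨P x, hPmem x⟩ : V) := fun x => rfl
  have hE : ∀ g, E ∘ₗ ρ g = ρ g ∘ₗ E := fun g => by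
    ext x
    have h1 : (⟨P (ρ g x), hPmem _⟩ : W₁.toSubmodule) =
        W₁.toRepresentation g ⟨P x, hPmem x⟩ :=
      Subtype.ext (LinearMap.congr_fun (hP g) x)
    have h2 := LinearMap.congr_fun (e.toIntertwiningMap.isIntertwining' g) ⟨P x, hPmem x⟩
    simp only [LinearMap.comp_apply, hE_apply, h1]
    exact congrArg Subtype.val h2
  have hPQ : ∀ x, P (Q x) = 0 := fun x => by
    refine (Submodule.disjoint_def.1 hd) _ (hPmem _) ?_
    have h := LinearMap.congr_fun (hρ P Q hP hQ) x
    simp only [LinearMap.comp_apply] at h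
    rw [h]
    exact hQmem _
  refine (Submodule.eq_bot_iff _).2 fun x hx => ?_
  have h := LinearMap.congr_fun (hρ E Q hE hQ) x
  simp only [LinearMap.comp_apply] at h
  have h3 : Q (E x) = E x := hQid _ (e.toLinearEquiv ⟨P x, hPmem x⟩).2
  have h4 : E (Q x) = 0 := by
    have : (⟨P (Q x), hPmem _⟩ : W₁.toSubmodule) = 0 := Subtype.ext (hPQ x)
    rw [hE_apply, this]
    simp
  rw [h3, h4, hE_apply] at h
  have h5 : (⟨P x, hPmem x⟩ : W₁.toSubmodule) = 0 :=
    e.toLinearEquiv.map_eq_zero_iff.1 (Subtype.ext h.symm)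
  rw [← hPid x hx]
  exact congrArg Subtype.val h5

/-- Pushing forward along the inclusion embeds the subrepresentations of `W` into those of `ρ` below
`W`, where an atom leaves only `⊥` and `W`. -/
theorem isIrreducible_toRepresentation {W : Subrepresentation ρ} (hW : IsAtom W) :
    W.toRepresentation.IsIrreducible := by
  let F : Subrepresentation W.toRepresentation → Subrepresentation ρ := fun σ =>
    { toSubmodule := σ.toSubmodule.map W.toSubmodule.subtype
      apply_mem_toSubmodule := by
        rintro g _ ⟨x, hx, rfl⟩
        exact ⟨W.toRepresentation g x, σ.apply_mem_toSubmodule g hx, rfl⟩ }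
  have hF : Function.Injective F := fun σ τ h => by
    apply Subrepresentation.toSubmodule_injective
    exact Submodule.map_injective_of_injective W.toSubmodule.injective_subtype
      (congrArg Subrepresentation.toSubmodule h)
  have hFle : ∀ σ, F σ ≤ W := by
    rintro σ _ ⟨x, _, rfl⟩
    exact x.2
  have hbot : F ⊥ = ⊥ := by
    apply Subrepresentation.toSubmodule_injective
    exact Submodule.map_bot _
  have htop : F ⊤ = W := by
    apply Subrepresentation.toSubmodule_injective
    exact Submodule.map_subtype_top _
  refine { exists_pair_ne := ⟨⊥, ⊤, fun h => hW.1 ?_⟩, eq_bot_or_eq_top := fun σ => ?_ }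
  · rw [← htop, ← h, hbot]
  · rcases hW.le_iff.1 (hFle σ) with h | h
    · exact Or.inl (hF (h.trans hbot.symm))
    · exact Or.inr (hF (h.trans htop.symm))

/-- A finite-dimensional complex representation of a finite group is an internal direct sum of
irreducible subrepresentations. -/
theorem exists_isInternal_isIrreducible [Finite Γ] [FiniteDimensional ℂ V]
    (ρ : Representation ℂ Γ V) :
    ∃ (k : ℕ) (W : Fin k → Subrepresentation ρ),
      DirectSum.IsInternal (fun i => (W i).toSubmodule) ∧
      ∀ i, (W i).toRepresentation.IsIrreducible := by
  have : IsSemisimpleModule ℂ[Γ] ρ.asModule := inferInstance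
  have : Module.Finite ℂ ρ.asModule := ‹FiniteDimensional ℂ V›
  have : Module.Finite ℂ[Γ] ρ.asModule := Module.Finite.of_restrictScalars_finite ℂ _ _
  obtain ⟨s, hind, hsup, hsimple⟩ :=
    IsSemisimpleModule.exists_sSupIndep_sSup_simples_eq_top ℂ[Γ] ρ.asModule
  have hfin : s.Finite := WellFoundedGT.finite_of_sSupIndep hind
  obtain ⟨k, ⟨e⟩⟩ := hfin.exists_equiv_fin
  refine ⟨k, fun i => Subrepresentation.ofSubmodule' (e.symm i : Submodule ℂ[Γ] ρ.asModule),
    ?_, fun i => isIrreducible_toRepresentation ?_⟩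
  · have h : DirectSum.IsInternal fun i => (e.symm i : Submodule ℂ[Γ] ρ.asModule) := by
      refine (DirectSum.isInternal_submodule_iff_iSupIndep_and_iSup_eq_top _).2 ⟨?_, ?_⟩
      · exact ((sSupIndep_iff _).1 hind).comp e.symm.injective
      · rw [e.symm.surjective.iSup_comp (fun x : s => (x : Submodule ℂ[Γ] ρ.asModule)),
          ← sSup_eq_iSup', hsup]
    -- `DirectSum.IsInternal` concerns only the additive map out of the direct sum, so the change of
    -- scalars from `ℂ[Γ]` to `ℂ` is harmless.
    exact h
  · have := hsimple _ (e.symm i).2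
    rw [isSimpleModule_iff_isAtom] at this
    exact (Subrepresentation.subrepresentationSubmoduleOrderIso.symm.isAtom_iff _).2 this

theorem HasCommutativeCommutant.isMultiplicityFree [Finite Γ] [FiniteDimensional ℂ V]
    (hρ : HasCommutativeCommutant ρ) : IsMultiplicityFree ρ := by
  obtain ⟨k, W, hW, hirr⟩ := exists_isInternal_isIrreducible ρ
  refine ⟨k, W, hW, hirr, ?_⟩
  rintro i j ⟨e⟩
  by_contra hij
  have h := hρ.eq_bot_of_equiv (hW.submodule_iSupIndep.pairwiseDisjoint hij) e
  have := (hirr i).toNontrivial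
  refine absurd (bot_ne_top (α := Subrepresentation (W i).toRepresentation)) ?_
  rw [not_not]
  apply Subrepresentation.toSubmodule_injective
  have : Subsingleton (W i).toSubmodule := by rw [h]; infer_instance
  exact Subsingleton.elim _ _

end RepresentationTheory

/-! ### Completely positive maps -/

section CompletelyPositive

open scoped Matrix.Norms.L2Operator MatrixOrder CStarAlgebra

variable {n : ℕ}

/-- Complete positivity of a linear map between matrix algebras. -/
def IsCP (Λ : Op n →ₗ[ℂ] Op n) : Prop :=
  ∃ Φ : Op n →CP Op n, ∀ X, Φ X = Λ X

theorem IsCP.of_map_nonneg {Λ : Op n →ₗ[ℂ] Op n}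
    (h : ∀ (k : ℕ) (M : CStarMatrix (Fin k) (Fin k) (Op n)), 0 ≤ M → 0 ≤ M.map Λ) : IsCP Λ :=
  ⟨⟨Λ, h⟩, fun _ => rfl⟩

theorem IsCP.map_nonneg {Λ : Op n →ₗ[ℂ] Op n} (h : IsCP Λ) {k : ℕ}
    {M : CStarMatrix (Fin k) (Fin k) (Op n)} (hM : 0 ≤ M) : 0 ≤ M.map Λ := by
  obtain ⟨Φ, hΦ⟩ := h
  have : M.map Λ = M.map Φ := by
    ext1 i j
    exact (hΦ _).symm
  rw [this]
  exact CompletelyPositiveMapClass.map_cstarMatrix_nonneg' Φ k M hM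

theorem IsCP.add {Λ Γ : Op n →ₗ[ℂ] Op n} (hΛ : IsCP Λ) (hΓ : IsCP Γ) : IsCP (Λ + Γ) :=
  .of_map_nonneg fun _ _ hM => add_nonneg (hΛ.map_nonneg hM) (hΓ.map_nonneg hM)

theorem IsCP.zero : IsCP (0 : Op n →ₗ[ℂ] Op n) :=
  .of_map_nonneg fun _ _ _ => le_rfl

theorem IsCP.sum {ι : Type*} {s : Finset ι} {Λ : ι → Op n →ₗ[ℂ] Op n} (h : ∀ i ∈ s, IsCP (Λ i)) :
    IsCP (∑ i ∈ s, Λ i) :=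
  Finset.sum_induction _ _ (fun _ _ => IsCP.add) IsCP.zero h

/-- On `k × k` blocks the map is conjugation by `diag(K, …, K)`, which preserves positivity. -/
theorem isCP_conjugate (K : Op n) :
    IsCP (LinearMap.mulLeft ℂ K ∘ₗ LinearMap.mulRight ℂ (star K)) := by
  refine .of_map_nonneg fun k M hM => ?_
  let D : CStarMatrix (Fin k) (Fin k) (Op n) := CStarMatrix.ofMatrix (Matrix.diagonal fun _ => K)
  have h : M.map (LinearMap.mulLeft ℂ K ∘ₗ LinearMap.mulRight ℂ (star K)) = D * M * star D := by
    have h1 : star D = CStarMatrix.ofMatrix (Matrix.diagonal fun _ => star K) :=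
      Matrix.diagonal_conjTranspose _
    ext1 i j
    have h2 : (D * M * star D) i j = ((Matrix.diagonal fun _ => K : Matrix (Fin k) (Fin k) (Op n)) *
        CStarMatrix.ofMatrix.symm M *
        (Matrix.diagonal fun _ => star K : Matrix (Fin k) (Fin k) (Op n))) i j := by rw [h1]; rfl
    rw [h2, Matrix.mul_diagonal, Matrix.diagonal_mul]
    simp [mul_assoc]
  rw [h]
  exact star_right_conjugate_nonneg hM D

/-- `X ↦ tr (B† B X) R R†`. -/
theorem isCP_trace_smul (B R : Op n) :
    IsCP ((Matrix.traceLinearMap (Bits n) ℂ ℂ ∘ₗ LinearMap.mulLeft ℂ (star B * B)).smulRight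
      (R * star R)) := by
  -- A Kraus decomposition, with Kraus operators `R |x⟩⟨y| B`.
  have h : (Matrix.traceLinearMap (Bits n) ℂ ℂ ∘ₗ LinearMap.mulLeft ℂ (star B * B)).smulRight
      (R * star R) = ∑ x : Bits n, ∑ y : Bits n,
        LinearMap.mulLeft ℂ (R * Matrix.single x y 1 * B) ∘ₗ
          LinearMap.mulRight ℂ (star (R * Matrix.single x y 1 * B)) := by
    ext1 X
    have hx : ∀ x y : Bits n, Matrix.single x y (1 : ℂ) * (B * X * star B) * Matrix.single y x 1 =
        (B * X * star B) y y • Matrix.single x x 1 := fun x y => by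
      rw [Matrix.single_mul_mul_single]; simp
    have hxy : ∀ x y : Bits n, R * Matrix.single x y 1 * B *
        (X * star (R * Matrix.single x y 1 * B)) =
        (B * X * star B) y y • (R * Matrix.single x x 1 * star R) := fun x y => by
      rw [← Matrix.smul_mul, ← Matrix.mul_smul, ← hx]
      simp [Matrix.star_eq_conjTranspose, mul_assoc]
    simp only [LinearMap.sum_apply, LinearMap.comp_apply, LinearMap.mulLeft_apply,
      LinearMap.mulRight_apply, hxy, ← Finset.sum_smul]
    rw [← Finset.smul_sum, ← Finset.sum_mul, ← Finset.mul_sum, Matrix.sum_single_one, mul_one]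
    simp [LinearMap.smulRight_apply, mul_assoc, Matrix.trace_mul_comm (star B)]
    rfl
  rw [h]
  exact .sum fun _ _ => .sum fun _ _ => isCP_conjugate _

theorem isQuantumChannel_iff {Λ : Op n →ₗ[ℂ] Op n} :
    IsQuantumChannel Λ ↔ IsCP Λ ∧ ∀ X, Matrix.trace (Λ X) = Matrix.trace X :=
  Iff.rfl

end CompletelyPositive

/-! ### Pauli operators and channels built from them -/

section Pauli

variable {n : ℕ}

theorem pauliMatrix_star (p : Fin 4) (a b : Fin 2) :
    star (pauliMatrix p a b) = pauliMatrix p b a := by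
  fin_cases p <;> fin_cases a <;> fin_cases b <;> simp [pauliMatrix]

theorem pauliMatrix_sq (p : Fin 4) (a c : Fin 2) :
    ∑ b, pauliMatrix p a b * pauliMatrix p b c = if a = c then 1 else 0 := by
  fin_cases p <;> fin_cases a <;> fin_cases c <;> simp [pauliMatrix]

theorem pauliString_star (s : PauliIdx n) : star (pauliString s) = pauliString s := by
  ext x y
  rw [Matrix.star_apply]
  simp only [pauliString, Matrix.of_apply, star_prod, pauliMatrix_star]

theorem pauliString_mul_self (s : PauliIdx n) : pauliString s * pauliString s = 1 := by
  ext x y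
  simp only [pauliString, Matrix.mul_apply, Matrix.of_apply, ← Finset.prod_mul_distrib]
  rw [← Fintype.prod_sum fun i b => pauliMatrix (s i) (x i) b * pauliMatrix (s i) b (y i)]
  simp only [pauliMatrix_sq, Matrix.one_apply]
  split_ifs with h
  · subst h
    simp
  · obtain ⟨i, hi⟩ := Function.ne_iff.1 h
    exact Finset.prod_eq_zero (Finset.mem_univ i) (by simp [hi])

theorem pauliString_zero : pauliString (0 : PauliIdx n) = 1 := by
  ext x y
  have h : ∀ i, pauliMatrix ((0 : PauliIdx n) i) (x i) (y i) = if x i = y i then 1 else 0 := by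
    intro i
    generalize x i = a
    generalize y i = b
    fin_cases a <;> fin_cases b <;> simp [pauliMatrix]
  simp only [pauliString, Matrix.of_apply, h, Matrix.one_apply]
  split_ifs with hxy
  · subst hxy
    simp
  · obtain ⟨i, hi⟩ := Function.ne_iff.1 hxy
    exact Finset.prod_eq_zero (Finset.mem_univ i) (by simp [hi])

theorem normPauli_star (s : PauliIdx n) : star (normPauli s) = normPauli s := by
  rw [normPauli, star_smul, pauliString_star]
  congr 1
  rw [← Complex.ofReal_inv]
  exact Complex.conj_ofReal _

theorem normPauli_zero :
    normPauli (0 : PauliIdx n) = ((Real.sqrt (2 ^ n) : ℂ))⁻¹ • (1 : Op n) := by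
  rw [normPauli, pauliString_zero]

theorem trace_normPauli_of_ne_zero {t : PauliIdx n} (ht : t ≠ 0) :
    Matrix.trace (normPauli t) = 0 := by
  have h := trace_normPauli_mul 0 t
  rw [normPauli_zero, Matrix.smul_mul, one_mul, Matrix.trace_smul, if_neg ht.symm,
    smul_eq_mul] at h
  refine (mul_eq_zero.1 h).resolve_left (inv_ne_zero ?_)
  exact_mod_cast (Real.sqrt_pos.2 (by positivity)).ne'

/-- The map `X ↦ tr (σ_s X) σ_t`, whose Pauli-Liouville matrix is a matrix unit. -/
noncomputable def pauliUnit (t s : PauliIdx n) : Op n →ₗ[ℂ] Op n :=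
  (Matrix.traceLinearMap (Bits n) ℂ ℂ ∘ₗ LinearMap.mulLeft ℂ (normPauli s)).smulRight (normPauli t)

theorem pauliUnit_apply (t s : PauliIdx n) (X : Op n) :
    pauliUnit t s X = Matrix.trace (normPauli s * X) • normPauli t :=
  rfl

theorem liouville_pauliUnit (t s : PauliIdx n) :
    liouville (pauliUnit t s) = Matrix.single t s 1 := by
  ext u v
  simp only [liouville, Matrix.of_apply, pauliUnit_apply, Matrix.mul_smul, Matrix.trace_smul,
    trace_normPauli_mul, Matrix.single_apply, smul_eq_mul]
  by_cases h1 : t = u <;> by_cases h2 : s = v <;> simp [h1, h2, eq_comm]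

theorem liouville_add (Λ Γ : Op n →ₗ[ℂ] Op n) :
    liouville (Λ + Γ) = liouville Λ + liouville Γ := by
  ext s t
  simp [liouville, mul_add]

theorem liouville_smul (c : ℂ) (Λ : Op n →ₗ[ℂ] Op n) :
    liouville (c • Λ) = c • liouville Λ := by
  ext s t
  simp [liouville]

theorem trace_pauliUnit_zero (X : Op n) :
    Matrix.trace (pauliUnit 0 0 X) = Matrix.trace X := by
  rw [pauliUnit_apply, normPauli_zero, Matrix.smul_mul, one_mul, Matrix.trace_smul,
    Matrix.trace_smul, Matrix.trace_smul, Matrix.trace_one, smul_eq_mul, smul_eq_mul, smul_eq_mul]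
  have h : (Fintype.card (Bits n) : ℂ) = 2 ^ n := by simp
  rw [h]
  calc _ = ((Real.sqrt (2 ^ n) : ℂ)⁻¹ * (Real.sqrt (2 ^ n) : ℂ)⁻¹) * 2 ^ n * Matrix.trace X := by
        ring
    _ = _ := by rw [sqrt_inv_mul_self, inv_mul_cancel₀ (by simp), one_mul]

/-- The completely depolarizing channel. -/
theorem isQuantumChannel_pauliUnit_zero : IsQuantumChannel (pauliUnit (0 : PauliIdx n) 0) := by
  refine isQuantumChannel_iff.2 ⟨?_, trace_pauliUnit_zero⟩
  have h := isCP_trace_smul (1 : Op n) (normPauli 0)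
  have h1 : pauliUnit (0 : PauliIdx n) 0 =
      (Matrix.traceLinearMap (Bits n) ℂ ℂ ∘ₗ LinearMap.mulLeft ℂ (star (1 : Op n) * 1)).smulRight
        (normPauli 0 * star (normPauli 0)) := by
    ext1 X
    rw [normPauli_star]
    simp [pauliUnit_apply, normPauli_zero, smul_smul]
    ring_nf
  rwa [h1]

/-- This is a measure-and-prepare channel: measure the sign `±` of `P_s`, then prepare the state
`2⁻ⁿ (1 ± ε P_t)`. The perturbation is traceless because `t ≠ 0`. -/
theorem isQuantumChannel_pauliUnit {t : PauliIdx n} (ht : t ≠ 0) (s : PauliIdx n) {ε : ℝ}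
    (hε : ε * ε = 1) : IsQuantumChannel (pauliUnit 0 0 + (ε : ℂ) • pauliUnit t s) := by
  refine isQuantumChannel_iff.2 ⟨?_, fun X => ?_⟩
  -- As `P_u² = 1`, the operator `1 ± P_u` is half its own square; this puts both the effects and
  -- the states in the form `B† B`.
  · have hsq : ∀ (a : ℝ) (u : PauliIdx n), a * a = 1 →
        star (1 + (a : ℂ) • pauliString u) = 1 + (a : ℂ) • pauliString u ∧
        (1 + (a : ℂ) • pauliString u) * (1 + (a : ℂ) • pauliString u) =
          (2 : ℂ) • (1 + (a : ℂ) • pauliString u) := fun a u ha => by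
      have ha' : (a : ℂ) * a = 1 := by exact_mod_cast ha
      constructor
      · rw [star_add, star_one, star_smul, pauliString_star]
        congr 2
        exact Complex.conj_ofReal a
      · simp only [mul_add, add_mul, one_mul, mul_one, Matrix.smul_mul, Matrix.mul_smul, smul_smul,
          pauliString_mul_self, ha', smul_add]
        module
    have hcp : ∀ a b : ℝ, a * a = 1 → b * b = 1 → ∀ c : ℝ,
        IsCP ((Matrix.traceLinearMap (Bits n) ℂ ℂ ∘ₗ
          LinearMap.mulLeft ℂ ((2 : ℂ) • (1 + (a : ℂ) • pauliString s))).smulRight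
            (((c * c * 2 : ℝ) : ℂ) • (1 + (b : ℂ) • pauliString t))) := fun a b ha hb c => by
      have h := isCP_trace_smul (1 + (a : ℂ) • pauliString s)
        ((c : ℂ) • (1 + (b : ℂ) • pauliString t))
      have hc : star (c : ℂ) = c := Complex.conj_ofReal c
      rw [(hsq a s ha).1, (hsq a s ha).2, star_smul, (hsq b t hb).1, Matrix.smul_mul,
        Matrix.mul_smul, (hsq b t hb).2, smul_smul, smul_smul, hc] at h
      push_cast
      exact h
    -- The 8 cancels three factors 2: one from squaring the effect, one from squaring the state, one
    -- from adding the two outcomes.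
    have h := (hcp 1 ε (by norm_num) hε √((8 * 2 ^ n)⁻¹)).add
      (hcp (-1) (-ε) (by norm_num) (by linarith) √((8 * 2 ^ n)⁻¹))
    rw [Real.mul_self_sqrt (by positivity)] at h
    convert h using 1
    ext1 X
    have hw := sqrt_inv_mul_self n
    simp only [LinearMap.add_apply, LinearMap.smul_apply, pauliUnit_apply,
      LinearMap.smulRight_apply, LinearMap.comp_apply, LinearMap.mulLeft_apply,
      Matrix.traceLinearMap_apply, normPauli, pauliString_zero, Matrix.smul_mul, Matrix.trace_smul,
      add_mul, one_mul, Matrix.trace_add, smul_smul, smul_eq_mul, smul_add]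
    generalize ((Real.sqrt (2 ^ n) : ℂ))⁻¹ = w at hw ⊢
    have h8 : (((8 * 2 ^ n)⁻¹ * 2 : ℝ) : ℂ) = w * w / 4 := by
      rw [hw]; push_cast; rw [mul_inv]; ring
    rw [h8]
    push_cast
    module
  · rw [LinearMap.add_apply, LinearMap.smul_apply, Matrix.trace_add, trace_pauliUnit_zero,
      pauliUnit_apply, Matrix.trace_smul, Matrix.trace_smul, trace_normPauli_of_ne_zero ht]
    simp

end Pauli

/-! ### Pauli-Liouville matrices of unitaries -/

section UnitaryChannel

open Matrix

variable {n : ℕ}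

theorem unitaryChannel_apply (U : QubitUnitary n) (X : Op n) :
    unitaryChannel U X = (U : Op n) * X * star (U : Op n) := by
  simp [unitaryChannel, mul_assoc]

theorem liouville_unitaryChannel_conjTranspose (U : QubitUnitary n) :
    (liouville (unitaryChannel U)).conjTranspose = liouville (unitaryChannel U⁻¹) := by
  ext s t
  have h : ((U⁻¹ : QubitUnitary n) : Op n) = star (U : Op n) := rfl
  simp only [Matrix.conjTranspose_apply, liouville, Matrix.of_apply, unitaryChannel_apply, h]
  rw [← Matrix.trace_conjTranspose]
  simp only [← Matrix.star_eq_conjTranspose, star_mul, star_star, normPauli_star]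
  rw [Matrix.trace_mul_comm, mul_assoc, ← mul_assoc (normPauli t), Matrix.trace_mul_comm]
  simp only [mul_assoc]

theorem liouville_unitaryChannel_mul (U W : QubitUnitary n) :
    liouville (unitaryChannel (U * W)) =
      liouville (unitaryChannel U) * liouville (unitaryChannel W) := by
  rw [← liouville_comp]
  congr 1
  ext1 X
  simp [unitaryChannel, mul_assoc]

theorem liouville_unitaryChannel_one : liouville (unitaryChannel (1 : QubitUnitary n)) = 1 := by
  rw [← liouville_id]
  congr 1
  ext1 X
  simp [unitaryChannel]

theorem liouville_unitaryChannel_mul_conjTranspose (U : QubitUnitary n) :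
    liouville (unitaryChannel U) * (liouville (unitaryChannel U)).conjTranspose = 1 := by
  rw [liouville_unitaryChannel_conjTranspose, ← liouville_unitaryChannel_mul, mul_inv_cancel,
    liouville_unitaryChannel_one]

theorem liouville_unitaryChannel_apply_zero (U : QubitUnitary n) (t : PauliIdx n) :
    liouville (unitaryChannel U) t 0 = (Pi.single 0 1 : PauliIdx n → ℂ) t := by
  have h : unitaryChannel U (normPauli 0) = normPauli 0 := by
    rw [unitaryChannel_apply, normPauli_zero, Matrix.mul_smul, Matrix.smul_mul, mul_one,
      Unitary.mul_star_self_of_mem U.2]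
  simp [liouville, h, trace_normPauli_mul, Pi.single_apply]

theorem liouville_unitaryChannel_zero_apply (U : QubitUnitary n) (t : PauliIdx n) :
    liouville (unitaryChannel U) 0 t = (Pi.single 0 1 : PauliIdx n → ℂ) t := by
  rw [← inv_inv U, ← liouville_unitaryChannel_conjTranspose, Matrix.conjTranspose_apply,
    liouville_unitaryChannel_apply_zero]
  by_cases h : t = 0 <;> simp [h]

theorem liouville_unitaryChannel_mulVec_single (U : QubitUnitary n) :
    liouville (unitaryChannel U) *ᵥ Pi.single 0 1 = Pi.single 0 1 := by
  ext t
  simp [liouville_unitaryChannel_apply_zero]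

theorem liouville_unitaryChannel_single_vecMul (U : QubitUnitary n) :
    Pi.single 0 1 ᵥ* liouville (unitaryChannel U) = Pi.single 0 1 := by
  ext t
  simp [liouville_unitaryChannel_zero_apply]

/-- Global phases act trivially in the Pauli-Liouville representation. -/
theorem liouville_unitaryChannel_of_mem_center {U : QubitUnitary n}
    (hU : U ∈ Subgroup.center (QubitUnitary n)) : liouville (unitaryChannel U) = 1 := by
  have h : ∀ t : PauliIdx n, unitaryChannel U (normPauli t) = normPauli t := fun t => by
    -- Pauli strings are themselves unitary, so a central `U` commutes with them; the center need
    -- not be identified with the scalars.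
    let P : QubitUnitary n := ⟨pauliString t, by
      rw [Matrix.mem_unitaryGroup_iff, pauliString_star, pauliString_mul_self]⟩
    have hP : pauliString t * (U : Op n) = U * pauliString t :=
      congrArg Subtype.val (Subgroup.mem_center_iff.1 hU P)
    rw [unitaryChannel_apply, normPauli, Matrix.mul_smul, ← hP, Matrix.smul_mul, mul_assoc,
      Unitary.mul_star_self_of_mem U.2, mul_one]
  ext s t
  simp [liouville, h, trace_normPauli_mul, Matrix.one_apply]

end UnitaryChannel

/-! ### From diagonalized twirls to a commutative commutant -/

section Twirl

open Matrix

variable {n : ℕ} (G : Subgroup (QubitUnitary n))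

/-- The twirl as a linear map on Pauli-Liouville matrices. -/
noncomputable def twirlMatrix [Fintype G] :
    Matrix (PauliIdx n) (PauliIdx n) ℂ →ₗ[ℂ] Matrix (PauliIdx n) (PauliIdx n) ℂ :=
  (Fintype.card G : ℂ)⁻¹ • ∑ g : G,
    LinearMap.mulRight ℂ (liouville (unitaryChannel (g : QubitUnitary n)))ᴴ ∘ₗ
      LinearMap.mulLeft ℂ (liouville (unitaryChannel (g : QubitUnitary n)))

theorem twirlMatrix_apply [Fintype G] (A : Matrix (PauliIdx n) (PauliIdx n) ℂ) :
    twirlMatrix G A = (Fintype.card G : ℂ)⁻¹ • ∑ g : G,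
      liouville (unitaryChannel (g : QubitUnitary n)) * A *
        (liouville (unitaryChannel (g : QubitUnitary n)))ᴴ := by
  simp [twirlMatrix]

theorem twirlMatrix_liouville [Fintype G] (Λ : Op n →ₗ[ℂ] Op n) :
    twirlMatrix G (liouville Λ) = twirl G Λ :=
  twirlMatrix_apply G _

/-- `A` commutes with the Pauli-Liouville matrices of all elements of `G`. -/
def CommutesWith (A : Matrix (PauliIdx n) (PauliIdx n) ℂ) : Prop :=
  ∀ g ∈ G, A * liouville (unitaryChannel g) = liouville (unitaryChannel g) * A

/-- `V` diagonalizes the `G`-twirls of all quantum channels. -/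
def DiagonalizesTwirls [Fintype G] (V : Matrix (PauliIdx n) (PauliIdx n) ℂ) : Prop :=
  ∀ Λ : Op n →ₗ[ℂ] Op n, IsQuantumChannel Λ → (V * twirl G Λ * V⁻¹).IsDiag

variable {G}

theorem CommutesWith.twirlMatrix_eq [Fintype G] {A : Matrix (PauliIdx n) (PauliIdx n) ℂ}
    (hA : CommutesWith G A) : twirlMatrix G A = A := by
  have h : ∀ g : G, liouville (unitaryChannel (g : QubitUnitary n)) * A *
      (liouville (unitaryChannel (g : QubitUnitary n)))ᴴ = A := fun g => by
    rw [← hA g g.2, mul_assoc, liouville_unitaryChannel_mul_conjTranspose, mul_one]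
  rw [twirlMatrix_apply]
  simp only [h, Finset.sum_const, Finset.card_univ]
  rw [← Nat.cast_smul_eq_nsmul ℂ, smul_smul, inv_mul_cancel₀ (by simp), one_smul]

theorem CommutesWith.conjTranspose {A : Matrix (PauliIdx n) (PauliIdx n) ℂ}
    (hA : CommutesWith G A) : CommutesWith G Aᴴ := fun g hg => by
  have h := congrArg Matrix.conjTranspose (hA g⁻¹ (G.inv_mem hg))
  rw [conjTranspose_mul, conjTranspose_mul, liouville_unitaryChannel_conjTranspose, inv_inv] at h
  exact h.symm

variable [Fintype G] {V : Matrix (PauliIdx n) (PauliIdx n) ℂ}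

/-- Twirls of quantum channels span the twirls of all matrices with first row `(c, 0, …, 0)`. -/
theorem DiagonalizesTwirls.isDiag_of_row (hV : DiagonalizesTwirls G V)
    {A : Matrix (PauliIdx n) (PauliIdx n) ℂ} (hA : ∀ s ≠ 0, A 0 s = 0) :
    (V * twirlMatrix G A * V⁻¹).IsDiag := by
  let D : Submodule ℂ (Matrix (PauliIdx n) (PauliIdx n) ℂ) :=
    { carrier := {A | (V * twirlMatrix G A * V⁻¹).IsDiag}
      add_mem' := fun {A B} (hA : IsDiag _) (hB : IsDiag _) => by
        simpa [mul_add, add_mul] using hA.add hB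
      zero_mem' := by simp
      smul_mem' := fun c A (hA : IsDiag _) => by simpa using hA.smul c }
  have hD : ∀ Λ : Op n →ₗ[ℂ] Op n, IsQuantumChannel Λ → liouville Λ ∈ D := fun Λ hΛ => by
    have h := hV Λ hΛ
    rwa [← twirlMatrix_liouville] at h
  have h00 : single 0 0 1 ∈ D := by
    rw [← liouville_pauliUnit]
    exact hD _ isQuantumChannel_pauliUnit_zero
  have hts : ∀ t ≠ 0, ∀ s, single t s 1 ∈ D := fun t ht s => by
    have h := hD _ (isQuantumChannel_pauliUnit ht s (ε := 1) (by norm_num))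
    rw [liouville_add, liouville_smul, liouville_pauliUnit, liouville_pauliUnit,
      Complex.ofReal_one, one_smul] at h
    -- The matrix unit is the difference of a perturbed depolarizing channel and the depolarizing
    -- channel.
    simpa using D.sub_mem h h00
  change A ∈ D
  rw [matrix_eq_sum_single A]
  refine D.sum_mem fun t _ => D.sum_mem fun s _ => ?_
  have h : single t s (A t s) = A t s • single t s (1 : ℂ) := by simp
  rw [h]
  by_cases ht : t = 0
  · subst ht
    by_cases hs : s = 0
    · subst hs
      exact D.smul_mem _ h00
    · rw [hA s hs, zero_smul]
      exact D.zero_mem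
  · exact D.smul_mem _ (hts t ht s)

theorem conj_mul_conj (hV : IsUnit V) (A B : Matrix (PauliIdx n) (PauliIdx n) ℂ) :
    V * A * V⁻¹ * (V * B * V⁻¹) = V * (A * B) * V⁻¹ := by
  have h : V⁻¹ * V = 1 := nonsing_inv_mul _ ((isUnit_iff_isUnit_det _).1 hV)
  calc _ = V * A * (V⁻¹ * V) * B * V⁻¹ := by simp only [mul_assoc]
    _ = _ := by rw [h]; simp only [mul_one, mul_assoc]

theorem eq_of_conj_eq (hV : IsUnit V) {A B : Matrix (PauliIdx n) (PauliIdx n) ℂ}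
    (h : V * A * V⁻¹ = V * B * V⁻¹) : A = B :=
  hV.mul_left_cancel ((isUnit_nonsing_inv_iff.2 hV).mul_right_cancel h)

/-- The identity operator spans the fixed points of the Pauli-Liouville representation. -/
theorem DiagonalizesTwirls.apply_eq_zero_of_fixed (hV : DiagonalizesTwirls G V) (hunit : IsUnit V)
    {x : PauliIdx n → ℂ} (hx : ∀ g ∈ G, liouville (unitaryChannel g) *ᵥ x = x) {t : PauliIdx n}
    (ht : t ≠ 0) : x t = 0 := by
  set e : PauliIdx n → ℂ := Pi.single 0 1 with he
  set y := x - x 0 • e with hy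
  have hy0 : y 0 = 0 := by simp [hy, he]
  have hfix : ∀ g ∈ G, liouville (unitaryChannel g) *ᵥ y = y := fun g hg => by
    rw [hy, mulVec_sub, mulVec_smul, hx g hg, he, liouville_unitaryChannel_mulVec_single]
  -- The matrix `y eᵀ` commutes with `G` because `y` is fixed as a column and `e` as a row. As `y 0
  -- = 0`, its row 0 vanishes and its square is zero; being diagonalizable, it must be zero.
  have hcomm : CommutesWith G (vecMulVec y e) := fun g hg => by
    rw [mul_vecMulVec, vecMulVec_mul, hfix g hg, he, liouville_unitaryChannel_single_vecMul]
  have hdiag := hV.isDiag_of_row (A := vecMulVec y e) fun s _ => by simp [vecMulVec_apply, hy0]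
  rw [hcomm.twirlMatrix_eq] at hdiag
  have hsq := conj_mul_conj hunit (vecMulVec y e) (vecMulVec y e)
  have hnil : vecMulVec y e * vecMulVec y e = 0 := by
    rw [vecMulVec_mul_vecMulVec]
    simp [he, hy0]
  rw [hnil, mul_zero, zero_mul, ← hdiag.diagonal_diag, diagonal_mul_diagonal,
    diagonal_eq_zero] at hsq
  have hz : V * vecMulVec y e * V⁻¹ = V * 0 * V⁻¹ := by
    rw [mul_zero, zero_mul, ← hdiag.diagonal_diag, diagonal_eq_zero]
    ext i
    exact mul_self_eq_zero.1 (congrFun hsq i)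
  have h := congrFun (congrFun (eq_of_conj_eq hunit hz) t) 0
  simpa [vecMulVec_apply, he, hy, ht] using h

/-- The commutant is closed under adjoints, so `Aᴴ` maps the fixed vector `Pi.single 0 1` to a fixed
vector. Its entries are the conjugates of row 0 of `A`, which therefore vanishes off the corner. -/
theorem DiagonalizesTwirls.isDiag_of_commutesWith (hV : DiagonalizesTwirls G V) (hunit : IsUnit V)
    {A : Matrix (PauliIdx n) (PauliIdx n) ℂ} (hA : CommutesWith G A) :
    (V * A * V⁻¹).IsDiag := by
  have h := hV.isDiag_of_row (A := A) fun s hs => by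
    have hfix : ∀ g ∈ G, liouville (unitaryChannel g) *ᵥ (Aᴴ *ᵥ Pi.single 0 1) =
        Aᴴ *ᵥ Pi.single 0 1 := fun g hg => by
      rw [mulVec_mulVec, ← hA.conjTranspose g hg, ← mulVec_mulVec,
        liouville_unitaryChannel_mulVec_single]
    simpa using hV.apply_eq_zero_of_fixed hunit hfix hs
  rwa [hA.twirlMatrix_eq] at h

theorem DiagonalizesTwirls.hasCommutativeCommutant (hV : DiagonalizesTwirls G V)
    (hunit : IsUnit V) : HasCommutativeCommutant (groupLiouvilleRep G) := by
  intro A B hA hB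
  have hmat : ∀ C : (PauliIdx n → ℂ) →ₗ[ℂ] (PauliIdx n → ℂ),
      (∀ g, C ∘ₗ groupLiouvilleRep G g = groupLiouvilleRep G g ∘ₗ C) →
      CommutesWith G (LinearMap.toMatrix' C) := fun C hC g hg => by
    have h := congrArg LinearMap.toMatrix' (hC ⟨g, hg⟩)
    have hg' : groupLiouvilleRep G ⟨g, hg⟩ = toLin' (liouville (unitaryChannel g)) := rfl
    rwa [hg', LinearMap.toMatrix'_comp, LinearMap.toMatrix'_comp,
      LinearMap.toMatrix'_toLin'] at h
  apply LinearMap.toMatrix'.injective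
  rw [LinearMap.toMatrix'_comp, LinearMap.toMatrix'_comp]
  apply eq_of_conj_eq hunit
  rw [← conj_mul_conj hunit, ← conj_mul_conj hunit,
    ← (hV.isDiag_of_commutesWith hunit (hmat A hA)).diagonal_diag,
    ← (hV.isDiag_of_commutesWith hunit (hmat B hB)).diagonal_diag, diagonal_mul_diagonal,
    diagonal_mul_diagonal]
  simp only [mul_comm]

end Twirl

/-! ### Cardinality bounds from a cyclic vector -/

section Cardinality

variable {n : ℕ} {G : Subgroup (QubitUnitary n)}

theorem groupLiouvilleRep_eq_of_mk_eq {g h : G}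
    (hgh : QuotientGroup.mk' (Subgroup.center (QubitUnitary n)) (g : QubitUnitary n) =
      QuotientGroup.mk' (Subgroup.center (QubitUnitary n)) h) :
    groupLiouvilleRep G g = groupLiouvilleRep G h := by
  have hc := liouville_unitaryChannel_of_mem_center (QuotientGroup.eq.1 hgh)
  have h1 : liouville (unitaryChannel (h : QubitUnitary n)) =
      liouville (unitaryChannel (g : QubitUnitary n)) := by
    rw [← mul_inv_cancel_left (g : QubitUnitary n) h, liouville_unitaryChannel_mul, hc, mul_one]
  exact congrArg Matrix.toLin' h1.symm

theorem pow_le_card_projectiveImage [Finite G] {v : PauliIdx n → ℂ}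
    (hv : Submodule.span ℂ (Set.range fun g => groupLiouvilleRep G g v) = ⊤) :
    4 ^ n ≤ Nat.card (projectiveImage G) := by
  have : Finite (projectiveImage G) :=
    .of_surjective _ (MonoidHom.subgroupMap_surjective _ G)
  have := Fintype.ofFinite (projectiveImage G)
  have hlift : ∀ q : projectiveImage G, ∃ g : G,
      QuotientGroup.mk' (Subgroup.center (QubitUnitary n)) (g : QubitUnitary n) = q := by
    rintro ⟨_, g, hg, rfl⟩
    exact ⟨⟨g, hg⟩, rfl⟩
  choose f hf using hlift
  -- One representative per phase class already gives the whole orbit of `v`.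
  have hspan : Submodule.span ℂ (Set.range fun q => groupLiouvilleRep G (f q) v) = ⊤ := by
    rw [eq_top_iff, ← hv, Submodule.span_le]
    rintro _ ⟨g, rfl⟩
    refine Submodule.subset_span ⟨⟨_, (g : QubitUnitary n), g.2, rfl⟩, ?_⟩
    exact LinearMap.congr_fun (groupLiouvilleRep_eq_of_mk_eq (hf _)) v
  have h := finrank_le_of_span_eq_top hspan
  rw [Nat.card_eq_fintype_card]
  simpa using h

theorem card_projectiveImage_le [Finite G] : Nat.card (projectiveImage G) ≤ Nat.card G :=
  Nat.card_le_card_of_surjective _ (MonoidHom.subgroupMap_surjective _ G)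

end Cardinality

end PauliTwirl

theorem lemma1 (n : ℕ) (G : Subgroup (PauliTwirl.QubitUnitary n)) [Fintype G]
    (hG : ∃ V : Matrix (PauliTwirl.PauliIdx n) (PauliTwirl.PauliIdx n) ℂ, IsUnit V ∧
      ∀ Λ : PauliTwirl.Op n →ₗ[ℂ] PauliTwirl.Op n, PauliTwirl.IsQuantumChannel Λ →
        (V * PauliTwirl.twirl G Λ * V⁻¹).IsDiag) :
    PauliTwirl.IsMultiplicityFree (PauliTwirl.groupLiouvilleRep G) ∧
      4 ^ n ≤ Nat.card G ∧
      4 ^ n ≤ Nat.card (PauliTwirl.projectiveImage G) := by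
  obtain ⟨V, hunit, hV⟩ := hG
  have hcomm := PauliTwirl.DiagonalizesTwirls.hasCommutativeCommutant (G := G) hV hunit
  obtain ⟨v, hv⟩ := hcomm.exists_cyclic
  have hcard := PauliTwirl.pow_le_card_projectiveImage hv
  exact ⟨hcomm.isMultiplicityFree, hcard.trans PauliTwirl.card_projectiveImage_le, hcard⟩
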